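/- Let $G$ be a group, let $P$ be a monoid with $P\cong\mathbb{N}^k$ for some $k\ge 1$ or $P\cong\bigoplus_{\mathbb{N}}\mathbb{N}$, and let $\theta$ be an action of $P$ on $G$ by injective group endomorphisms (so $\theta_{pq}=\theta_p\theta_q$ and $\theta_{1_P}=\mathrm{id}_G$) which respects the order, that is, $\theta_p(G)\cap\theta_q(G)=\theta_r(G)$ whenever $pP\cap qP=rP$. Let $S=G\rtimes_\theta P$ be the semidirect product, i.e. the set $G\times P$ with $(g,p)(h,q)=(g\,\theta_p(h),pq)$. Let $\mathcal{J}(S)$ be the smallest family of subsets of $S$ that contains $\emptyset$ and $S$ and is closed under $X\mapsto pX$ and $X\mapsto p^{-1}X=\{y\in S: py\in X\}$ for all $p\in S$. Let $C^*(S)$ be the full semigroup $C^*$-algebra, that is, the universal unital $C^*$-algebra generated by isometries $(v_p)_{p\in S}$ and projections $(e_X)_{X\in\mathcal{J}(S)}$ subject to $v_pv_q=v_{pq}$, $v_pe_Xv_p^*=e_{pX}$, $e_\emptyset=0$, $e_S=1$ and $e_Xe_Y=e_{X\cap Y}$. Let $\mathcal{D}\subseteq C^*(S)$ be the $C^*$-subalgebra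 generated by $\{e_X: X\in\mathcal{J}(S)\}$. Assume that (i) $\bigcap_{p\in P}\theta_p(G)=\{1_G\}$; (ii) the index $[G:\theta_p(G)]$ is infinite for every $p\ne 1_P$; (iii) there is a conditional expectation $\Phi_{\mathcal{D}}\colon C^*(S)\to\mathcal{D}$ with $\Phi_{\mathcal{D}}(v_pv_p^*)=v_pv_p^*$ for all $p\in S$ and $\Phi_{\mathcal{D}}(v_pv_q^*)=0$ for all $p\neq q$ in $S$, and it is faithful, i.e. $\Phi_{\mathcal{D}}(a)\neq 0$ for every positive $a\neq 0$. Then $C^*(S)$ is purely infinite and simple: it is nonzero, has no closed two-sided ideals other than $\{0\}$ and $C^*(S)$, and each of its nonzero hereditary $C^*$-subalgebras contains an infinite projection (a projection Murray--von Neumann equivalent to a proper subprojection of itself). -/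

import Mathlib

open scoped ENNReal

universe u v w

noncomputable section

/-! ### Semidirect products of a group by an action of a monoid -/

/-- The semidirect product `G ⋊_θ P` of a group `G` by an action `θ` of a monoid `P` by
endomorphisms of `G`: the set `G × P` with `(g, p) (h, q) = (g θ_p(h), p q)`. -/
@[ext]
structure SemidirectMonoid {G : Type u} {P : Type v} [Group G] [Monoid P]
    (θ : P →* Monoid.End G) where
  left : G
  right : P

namespace SemidirectMonoid

variable {G : Type u} {P : Type v} [Group G] [Monoid P] {θ : P →* Monoid.End G}

instance : Mul (SemidirectMonoid θ) := ⟨fun a b => ⟨a.left * θ a.right b.left, a.right * b.right⟩⟩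

instance : One (SemidirectMonoid θ) := ⟨⟨1, 1⟩⟩

@[simp] theorem mul_left (a b : SemidirectMonoid θ) :
    (a * b).left = a.left * θ a.right b.left := rfl

@[simp] theorem mul_right (a b : SemidirectMonoid θ) : (a * b).right = a.right * b.right := rfl

@[simp] theorem one_left : (1 : SemidirectMonoid θ).left = 1 := rfl

@[simp] theorem one_right : (1 : SemidirectMonoid θ).right = 1 := rfl

instance : Monoid (SemidirectMonoid θ) where
  mul_assoc a b c := by ext <;> simp [mul_assoc]
  one_mul a := by ext <;> simp
  mul_one a := by ext <;> simp

end SemidirectMonoid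

/-- The principal right ideal `pS`. -/
def principalRightIdeal {S : Type u} [Mul S] (p : S) : Set S := Set.range fun s => p * s

/-- The action `θ` respects the order on `P`: whenever `pP ∩ qP = rP` one has
`θ_p(G) ∩ θ_q(G) = θ_r(G)`. -/
def RespectsOrder {G : Type u} {P : Type v} [Group G] [Monoid P] (θ : P →* Monoid.End G) : Prop :=
  ∀ p q r : P, principalRightIdeal p ∩ principalRightIdeal q = principalRightIdeal r →
    MonoidHom.range (θ p) ⊓ MonoidHom.range (θ q) = MonoidHom.range (θ r)

/-! ### Constructible right ideals -/

/-- The constructible right ideals of `S`: the smallest family of subsets containing `∅` and `S`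
and closed under `X ↦ pX` and `X ↦ p⁻¹X = {y | p y ∈ X}`. -/
inductive IsConstructible {S : Type u} [Semigroup S] : Set S → Prop
  | empty : IsConstructible ∅
  | univ : IsConstructible Set.univ
  | image (p : S) (X : Set S) : IsConstructible X → IsConstructible ((fun x => p * x) '' X)
  | preimage (p : S) (X : Set S) : IsConstructible X → IsConstructible ((fun y => p * y) ⁻¹' X)

/-- The family `J(S)` of constructible right ideals. -/
def ConstructibleIdeal (S : Type u) [Semigroup S] : Type u := {X : Set S // IsConstructible X}

namespace ConstructibleIdeal

variable {S : Type u} [Semigroup S]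

/-- The ideal `∅`. -/
def empty : ConstructibleIdeal S := ⟨∅, .empty⟩

/-- The ideal `S`. -/
def univ : ConstructibleIdeal S := ⟨Set.univ, .univ⟩

/-- The ideal `pX`. -/
def translate (p : S) (X : ConstructibleIdeal S) : ConstructibleIdeal S :=
  ⟨(fun x => p * x) '' X.1, .image p _ X.2⟩

end ConstructibleIdeal

/-- In a left cancellative semigroup the constructible right ideals are closed under
intersection. -/
theorem IsConstructible.inter {S : Type u} [Semigroup S] [IsLeftCancelMul S] {X Y : Set S}
    (hX : IsConstructible X) (hY : IsConstructible Y) : IsConstructible (X ∩ Y) := by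
  induction hX generalizing Y with
  | empty => simpa using IsConstructible.empty
  | univ => simpa using hY
  | image p X _ ih =>
    have h : ((fun x => p * x) '' X) ∩ Y = (fun x => p * x) '' (X ∩ (fun y => p * y) ⁻¹' Y) :=
      (Set.image_inter_preimage _ _ _).symm
    rw [h]
    exact .image p _ (ih (.preimage p _ hY))
  | preimage p X _ ih =>
    have h : ((fun y => p * y) ⁻¹' X) ∩ Y
        = (fun y => p * y) ⁻¹' (X ∩ (fun x => p * x) '' Y) := by
      rw [Set.preimage_inter, Set.preimage_image_eq _ (mul_right_injective p)]
    rw [h]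
    exact .preimage p _ (ih (.image p _ hY))

/-! ### The full semigroup C*-algebra -/

/-- Isometries `v_p` (`p ∈ S`) and projections `e_X` (`X ∈ J(S)`) in a unital C*-algebra `B`
satisfying the defining relations (L1)-(L4) of the full semigroup C*-algebra. -/
structure SemigroupRep (S : Type u) [Semigroup S] (B : Type w) [CStarAlgebra B] where
  v : S → B
  e : ConstructibleIdeal S → B
  isometry : ∀ p, star (v p) * v p = 1
  projection : ∀ X, IsStarProjection (e X)
  v_mul : ∀ p q, v p * v q = v (p * q)
  v_conj : ∀ p X, v p * e X * star (v p) = e (X.translate p)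
  e_empty : e ConstructibleIdeal.empty = 0
  e_univ : e ConstructibleIdeal.univ = 1
  e_inter : ∀ X Y Z : ConstructibleIdeal S, Z.1 = X.1 ∩ Y.1 → e X * e Y = e Z

/-- All representations of the relations in nonzero unital C*-algebras. -/
structure RepIndex (S : Type u) [Semigroup S] : Type (u + 1) where
  alg : Type u
  [cstar : CStarAlgebra alg]
  [nontriv : Nontrivial alg]
  rep : SemigroupRep S alg

namespace FullCStar

variable (S : Type u) [Semigroup S]

instance (i : RepIndex S) : CStarAlgebra i.alg := i.cstar

instance (i : RepIndex S) : Nontrivial i.alg := i.nontriv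

/-- The `ℓ^∞`-direct sum of all the C*-algebras carrying a representation of the relations. -/
abbrev BigSum : Type (u + 1) := lp (fun i : RepIndex S => i.alg) ∞

instance (i : RepIndex S) : NormOneClass i.alg := CStarRing.instNormOneClassOfNontrivial

instance : CStarAlgebra (BigSum S) where

variable {S}

theorem norm_le_one_of_isometry {B : Type u} [CStarAlgebra B] [Nontrivial B] {a : B}
    (h : star a * a = 1) : ‖a‖ ≤ 1 := by
  have h1 : ‖a‖ * ‖a‖ = 1 := by rw [← CStarRing.norm_star_mul_self, h, CStarRing.norm_one]
  nlinarith [norm_nonneg a]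

/-- The direct sum of all the isometries `v_p`. -/
def bigV (p : S) : BigSum S :=
  ⟨fun i => i.rep.v p, memℓp_infty ⟨1, by
    rintro _ ⟨i, rfl⟩
    exact norm_le_one_of_isometry (i.rep.isometry p)⟩⟩

/-- The direct sum of all the projections `e_X`. -/
def bigE (X : ConstructibleIdeal S) : BigSum S :=
  ⟨fun i => i.rep.e X, memℓp_infty ⟨1, by
    rintro _ ⟨i, rfl⟩
    exact (i.rep.projection X).norm_le⟩⟩

variable (S)

/-- The C*-subalgebra of the direct sum generated by the universal isometries and projections. -/
def subalgebra : StarSubalgebra ℂ (BigSum S) :=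
  (StarAlgebra.adjoin ℂ (Set.range (bigV (S := S)) ∪ Set.range (bigE (S := S)))).topologicalClosure

instance : IsClosed (subalgebra S : Set (BigSum S)) :=
  StarSubalgebra.isClosed_topologicalClosure _

end FullCStar

/-- The full semigroup C*-algebra `C*(S)`: the universal unital C*-algebra generated by isometries
`v_p` (`p ∈ S`) and projections `e_X` (`X ∈ J(S)`) subject to (L1)-(L4), realised inside the direct
sum of all representations of these relations. -/
def FullCStar (S : Type u) [Semigroup S] : Type (u + 1) := FullCStar.subalgebra S

namespace FullCStar

variable (S : Type u) [Semigroup S]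

instance : CStarAlgebra (FullCStar S) := inferInstanceAs (CStarAlgebra (subalgebra S))

/-- The order of a C*-algebra: `a ≤ b` iff `b - a` is positive. -/
instance : PartialOrder (FullCStar S) := CStarAlgebra.spectralOrder (FullCStar S)

instance : StarOrderedRing (FullCStar S) := CStarAlgebra.spectralOrderedRing (FullCStar S)

variable {S}

/-- The generating isometry `v_p` of `C*(S)`. -/
def v (p : S) : FullCStar S :=
  ⟨bigV p, StarSubalgebra.le_topologicalClosure _ (StarAlgebra.subset_adjoin _ _ (Or.inl ⟨p, rfl⟩))⟩

/-- The generating projection `e_X` of `C*(S)`. -/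
def e (X : ConstructibleIdeal S) : FullCStar S :=
  ⟨bigE X, StarSubalgebra.le_topologicalClosure _ (StarAlgebra.subset_adjoin _ _ (Or.inr ⟨X, rfl⟩))⟩

variable (S)

/-- The generators of `C*(S)` satisfy the defining relations. -/
def universalRep : SemigroupRep S (FullCStar S) where
  v := v
  e := e
  isometry p := Subtype.ext <| lp.ext <| funext fun i => i.rep.isometry p
  projection X :=
    ⟨Subtype.ext <| lp.ext <| funext fun i => (i.rep.projection X).isIdempotentElem,
      Subtype.ext <| lp.ext <| funext fun i => (i.rep.projection X).isSelfAdjoint⟩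
  v_mul p q := Subtype.ext <| lp.ext <| funext fun i => i.rep.v_mul p q
  v_conj p X := Subtype.ext <| lp.ext <| funext fun i => i.rep.v_conj p X
  e_empty := Subtype.ext <| lp.ext <| funext fun i => i.rep.e_empty
  e_univ := Subtype.ext <| lp.ext <| funext fun i => i.rep.e_univ
  e_inter X Y Z h := Subtype.ext <| lp.ext <| funext fun i => i.rep.e_inter X Y Z h

variable {S}

/-- The universal property of `C*(S)`. -/
theorem exists_lift {B : Type u} [CStarAlgebra B] [Nontrivial B] (ρ : SemigroupRep S B) :
    ∃ π : FullCStar S →⋆ₐ[ℂ] B, (∀ p, π (v p) = ρ.v p) ∧ ∀ X, π (e X) = ρ.e X := by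
  let i : RepIndex S := { alg := B, rep := ρ }
  let ev : BigSum S →⋆ₐ[ℂ] B :=
    { toFun := fun f => f i
      map_one' := rfl
      map_mul' := fun _ _ => rfl
      map_zero' := rfl
      map_add' := fun _ _ => rfl
      commutes' := fun _ => rfl
      map_star' := fun _ => rfl }
  exact ⟨ev.comp (subalgebra S).subtype, fun _ => rfl, fun _ => rfl⟩

variable (S)

/-- The diagonal `D`: the C*-subalgebra of `C*(S)` generated by the projections `e_X`. -/
def diagonal : StarSubalgebra ℂ (FullCStar S) :=
  (StarAlgebra.adjoin ℂ (Set.range (e (S := S)))).topologicalClosure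

end FullCStar

/-! ### Conditional expectations, simplicity and pure infiniteness -/

/-- A linear map `Φ : A → D` is a conditional expectation of the C*-algebra `A` onto the
C*-subalgebra `D`: a positive contractive `D`-bimodule map restricting to the identity on `D`. -/
structure IsConditionalExpectation {A : Type u} [CStarAlgebra A] [PartialOrder A]
    [StarOrderedRing A] (D : StarSubalgebra ℂ A) (Φ : A →ₗ[ℂ] D) : Prop where
  apply_coe : ∀ d : D, Φ (d : A) = d
  norm_le : ∀ a, ‖(Φ a : A)‖ ≤ ‖a‖
  nonneg : ∀ a, 0 ≤ a → 0 ≤ (Φ a : A)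
  bimodule : ∀ (d d' : D) (a : A), Φ (d * a * d') = d * Φ a * d'

/-- `Φ` is faithful on positive elements. -/
def IsFaithfulOnPositive {A : Type u} [CStarAlgebra A] [PartialOrder A]
    [StarOrderedRing A] {D : StarSubalgebra ℂ A} (Φ : A →ₗ[ℂ] D) : Prop :=
  ∀ a : A, 0 ≤ a → Φ a = 0 → a = 0

open Classical in
/-- `Φ` satisfies the formula that characterises `Φ_D`: `Φ_D(v_p v_q^*)` is `v_p v_p^*` if `p = q`
and `0` otherwise. -/
def IsDiagonalMap (S : Type u) [Semigroup S]
    (Φ : FullCStar S →ₗ[ℂ] FullCStar.diagonal S) : Prop :=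
  ∀ p q : S, (Φ (FullCStar.v p * star (FullCStar.v q)) : FullCStar S) =
    if p = q then FullCStar.v p * star (FullCStar.v p) else 0

/-- A C*-algebra is simple if it is nonzero and its only closed two-sided ideals are the trivial
ones. -/
def IsSimpleCStar (A : Type u) [CStarAlgebra A] : Prop :=
  Nontrivial A ∧ ∀ I : TwoSidedIdeal A, IsClosed (I : Set A) → I = ⊥ ∨ I = ⊤

/-- A hereditary C*-subalgebra: a closed (possibly non-unital) *-subalgebra `B` such that
`0 ≤ a ≤ b ∈ B` implies `a ∈ B`. -/
def IsHereditary {A : Type u} [CStarAlgebra A] [PartialOrder A] [StarOrderedRing A]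
    (B : NonUnitalStarSubalgebra ℂ A) : Prop :=
  IsClosed (B : Set A) ∧ ∀ a b : A, 0 ≤ a → a ≤ b → b ∈ B → a ∈ B

/-- A projection is infinite if it is Murray-von Neumann equivalent to a proper subprojection of
itself. -/
def IsInfiniteProjection {A : Type u} [CStarAlgebra A] [PartialOrder A] [StarOrderedRing A]
    (p : A) : Prop :=
  IsStarProjection p ∧ ∃ s : A, star s * s = p ∧ s * star s ≤ p ∧ s * star s ≠ p

/-- Pure infiniteness of a simple C*-algebra: every nonzero hereditary C*-subalgebra contains an
infinite projection. -/
def IsPurelyInfinite (A : Type u) [CStarAlgebra A] [PartialOrder A] [StarOrderedRing A] : Prop :=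
  ∀ B : NonUnitalStarSubalgebra ℂ A, IsHereditary B → B ≠ ⊥ → ∃ p ∈ B, IsInfiniteProjection p

end

/-! Everything rests on `exists_isUnit_compression`: for every nonzero a ≥ 0 some v_c^* a v_c is
invertible. Simplicity follows at once, since an ideal containing x ≠ 0 contains the unit v_c^* x^*
x v_c. For pure infiniteness take x ≠ 0 in the hereditary subalgebra B; with z the inverse square
root of v_c^* x^* x v_c, the element w = x v_c z is an isometry and w w^* lies in B. If v_d is not
unitary, w v_d w^* makes w w^* equivalent to a proper subprojection of itself.

To find c, faithfulness gives Φ(a) ≠ 0, and since D is commutative some character χ of D satisfies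
χ(Φ(a)) ≠ 0. Because S is right LCM, the v_p v_q^* span a dense `*`-subalgebra, so a may be replaced
by a finite combination of them. On finitely many v_p v_q^*, compression by a suitable v_c equals χ
∘ Φ (`exists_compression`): c is a common multiple of the p with χ(v_p v_p^*) = 1, pushed further
right so that cS misses pS for the other p, and once more so that the terms with p ≠ q vanish.

The pushing needs the two conditions `avoid` and `unit_sep`. For G ⋊ P, `avoid` comes from infinite
index through B. H. Neumann's lemma on coset covers, `unit_sep` from the trivial intersection of the
θ_p(G), and least common multiples from θ respecting the order. -/

/-- A cancellative right LCM monoid in which finitely many proper principal right ideals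
always miss a principal right ideal, and in which no nontrivial unit acts trivially on the
principal right ideals. -/
structure IsSeparatedLCM (S : Type u) [Monoid S] : Prop where
  left_cancel : ∀ a b c : S, a * b = a * c → b = c
  right_cancel : ∀ a b c : S, a * c = b * c → a = b
  lcm : ∀ a b : S, (∀ x y, a * x ≠ b * y) ∨
    ∃ m n, a * m = b * n ∧ ∀ x y, a * x = b * y → ∃ z, a * x = a * m * z
  avoid : ∀ F : Finset S, (∀ a ∈ F, ¬ IsUnit a) → ∃ s, ∀ a ∈ F, ∀ x y, s * x ≠ a * y
  unit_sep : ∀ u : S, IsUnit u → u ≠ 1 → ∃ d, ∀ x y, u * d * x ≠ d * y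
  exists_nonunit : ∃ a : S, ¬ IsUnit a

/-! ### Disjointness of principal right ideals in separated LCM monoids -/

namespace IsSeparatedLCM

variable {S : Type u} [Monoid S]

/-- If pS ∩ qS = pmS, then p⁻¹(qS) = mS by left cancellation. Hence each e_X is 0 or a range
projection v_p v_p^*. -/
theorem constructible (hS : IsSeparatedLCM S) {X : Set S} (hX : IsConstructible X) :
    X = ∅ ∨ ∃ p, X = principalRightIdeal p := by
  induction hX with
  | empty => exact Or.inl rfl
  | univ => exact Or.inr ⟨1, by simp [principalRightIdeal]⟩
  | image p X _ ih =>
    rcases ih with rfl | ⟨q, rfl⟩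
    · simp
    · refine Or.inr ⟨p * q, ?_⟩
      simp [principalRightIdeal, ← Set.range_comp, Function.comp_def, mul_assoc]
  | preimage p X _ ih =>
    rcases ih with rfl | ⟨q, rfl⟩
    · simp
    · rcases hS.lcm p q with h | ⟨m, n, hmn, h⟩
      · left
        ext x
        simpa [principalRightIdeal] using fun y hy => h x y hy.symm
      · refine Or.inr ⟨m, Set.ext fun x => ⟨?_, ?_⟩⟩
        · rintro ⟨y, hy⟩
          obtain ⟨z, hz⟩ := h x y hy.symm
          exact ⟨z, (hS.left_cancel p _ _ (by rw [hz, mul_assoc])).symm⟩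
        · rintro ⟨z, rfl⟩
          exact ⟨n * z, by simp only [← mul_assoc, hmn]⟩

/-- Write aS ∩ bS = amS with am = bn. If m is not a unit, choose dS disjoint from mS: a common
element adx = bdy would put dx in mS. The case of n is symmetric. If both are units, b = au for the
unit u = mn⁻¹ ≠ 1, and `unit_sep` applies. -/
theorem exists_disjoint_pair (hS : IsSeparatedLCM S) {a b : S} (hab : a ≠ b) :
    ∃ d, ∀ x y, a * d * x ≠ b * d * y := by
  rcases hS.lcm a b with h | ⟨m, n, hmn, h⟩
  · exact ⟨1, fun x y => by simpa using h x y⟩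
  by_cases hm : IsUnit m
  · by_cases hn : IsUnit n
    · obtain ⟨m, rfl⟩ := hm
      obtain ⟨n, rfl⟩ := hn
      have hb : b = a * (m * n⁻¹ : Sˣ) := by
        rw [Units.val_mul, ← mul_assoc, hmn, mul_assoc, Units.mul_inv, mul_one]
      have hne : ((m * n⁻¹ : Sˣ) : S) ≠ 1 := by
        rintro h1
        rw [h1, mul_one] at hb
        exact hab hb.symm
      obtain ⟨d, hd⟩ := hS.unit_sep _ (m * n⁻¹).isUnit hne
      refine ⟨d, fun x y hxy => hd y x (hS.left_cancel a _ _ ?_)⟩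
      rw [hb] at hxy
      simpa only [mul_assoc] using hxy.symm
    · obtain ⟨d, hd⟩ := hS.avoid {n} (by simpa using hn)
      refine ⟨d, fun x y hxy => ?_⟩
      obtain ⟨z, hz⟩ := h (d * x) (d * y) (by simpa only [mul_assoc] using hxy)
      refine hd n (Finset.mem_singleton_self n) y z (hS.left_cancel b _ _ ?_)
      rw [← mul_assoc b n, ← hmn, ← hz, ← mul_assoc, ← mul_assoc, hxy]
  · obtain ⟨d, hd⟩ := hS.avoid {m} (by simpa using hm)
    refine ⟨d, fun x y hxy => ?_⟩
    obtain ⟨z, hz⟩ := h (d * x) (d * y) (by simpa only [mul_assoc] using hxy)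
    exact hd m (Finset.mem_singleton_self m) x z
      (hS.left_cancel a _ _ (by rw [hz, mul_assoc]))

/-- This removes off-diagonal terms: if c = pa = qb, then v_{cd}^* v_p v_q^* v_{cd} = v_{ad}^*
v_{bd}, which vanishes when adS and bdS are disjoint. The pairs are treated one at a time, as
extending d on the right preserves the disjointness already gained. -/
theorem exists_disjoint_pairs (hS : IsSeparatedLCM S) (c : S) (K : Finset (S × S)) :
    ∃ d, ∀ k ∈ K, k.1 ≠ k.2 → ∀ a b, c = k.1 * a → c = k.2 * b →
      ∀ x y, a * d * x ≠ b * d * y := by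
  classical
  induction K using Finset.induction_on with
  | empty => exact ⟨1, by simp⟩
  | insert k K _ ih =>
    obtain ⟨d, hd⟩ := ih
    by_cases hk : ∃ a b, c = k.1 * a ∧ c = k.2 * b ∧ k.1 ≠ k.2
    · obtain ⟨a, b, ha, hb, hne⟩ := hk
      have hab : a * d ≠ b * d := fun h => hne <| by
        obtain rfl := hS.right_cancel _ _ _ h
        exact hS.right_cancel _ _ _ (ha.symm.trans hb)
      obtain ⟨d', hd'⟩ := hS.exists_disjoint_pair hab
      refine ⟨d * d', fun l hl hl' a' b' ha' hb' x y => ?_⟩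
      rcases Finset.mem_insert.1 hl with rfl | hl
      · obtain rfl := hS.left_cancel _ _ _ (ha.symm.trans ha')
        obtain rfl := hS.left_cancel _ _ _ (hb.symm.trans hb')
        simpa only [mul_assoc] using hd' x y
      · simpa only [mul_assoc] using hd l hl hl' a' b' ha' hb' (d' * x) (d' * y)
    · refine ⟨d, fun l hl hl' a' b' ha' hb' => ?_⟩
      rcases Finset.mem_insert.1 hl with rfl | hl
      · exact absurd ⟨a', b', ha', hb', hl'⟩ hk
      · exact hd l hl hl' a' b' ha' hb'

/-- The x with rx ∈ aS, if any, form an ideal mS, and m is not a unit because r ∉ aS. It is enough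
that s avoids these finitely many m. -/
theorem exists_avoiding (hS : IsSeparatedLCM S) (r : S) (F : Finset S) (hF : ∀ a ∈ F, ∀ x, r ≠ a * x) :
    ∃ s, ∀ a ∈ F, ∀ x y, r * s * x ≠ a * y := by
  classical
  have key : ∀ a : S, ∃ m : S, ¬ IsUnit m ∧ (a ∈ F → ∀ x y, r * x = a * y → ∃ z, x = m * z) := by
    intro a
    -- A harmless default for those a that impose no condition.
    obtain ⟨m₀, hm₀⟩ := hS.exists_nonunit
    by_cases ha : a ∈ F
    · rcases hS.lcm r a with h | ⟨m, n, hmn, h⟩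
      · exact ⟨m₀, hm₀, fun _ x y hxy => absurd hxy (h x y)⟩
      · refine ⟨m, ?_, fun _ x y hxy => ?_⟩
        · rintro ⟨m, rfl⟩
          apply hF a ha (n * (m⁻¹ : Sˣ))
          rw [← mul_assoc, ← hmn, mul_assoc, Units.mul_inv, mul_one]
        · obtain ⟨z, hz⟩ := h x y hxy
          exact ⟨z, hS.left_cancel r _ _ (by rw [hz, mul_assoc])⟩
    · exact ⟨m₀, hm₀, fun h => absurd h ha⟩
  choose f hf hf' using key
  obtain ⟨s, hs⟩ := hS.avoid (F.image f) (by simpa using fun a _ => hf a)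
  refine ⟨s, fun a ha x y hxy => ?_⟩
  obtain ⟨z, hz⟩ := hf' a ha (s * x) y (by rw [← hxy, mul_assoc])
  exact hs (f a) (Finset.mem_image_of_mem f ha) x z hz

end IsSeparatedLCM

/-! ### The semidirect product is a separated LCM monoid -/

/-- A commutative cancellative monoid with trivial units and least common multiples. -/
structure IsLCMMonoid (P : Type v) [Monoid P] : Prop where
  comm : ∀ p q : P, p * q = q * p
  cancel : ∀ p q r : P, p * q = p * r → q = r
  left_eq_one : ∀ p q : P, p * q = 1 → p = 1
  lcm : ∀ p q : P, ∃ m n, p * m = q * n ∧ ∀ x y, p * x = q * y → ∃ z, p * x = p * m * z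
  exists_ne_one : ∃ p : P, p ≠ 1

theorem isLCMMonoid_of_mulEquiv {P : Type v} [Monoid P] {M : Type w} [AddCommMonoid M]
    [IsCancelAdd M] [Lattice M] [CanonicallyOrderedAdd M] [Nontrivial M]
    [IsOrderedAddMonoid M]
    (φ : P ≃* Multiplicative M) : IsLCMMonoid P where
  comm p q := φ.injective (by rw [map_mul, map_mul, mul_comm])
  cancel p q r h := φ.injective <| Multiplicative.toAdd.injective <|
    add_left_cancel (a := (φ p).toAdd) <| by
      simpa using congrArg (fun t => (φ t).toAdd) h
  left_eq_one p q h := φ.injective <| Multiplicative.toAdd.injective <| by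
    have h' : (φ p).toAdd + (φ q).toAdd = 0 := by
      simpa using congrArg (fun t => (φ t).toAdd) h
    have h0 : (φ p).toAdd ≤ 0 := h' ▸ le_self_add
    simpa using h0
  lcm p q := by
    obtain ⟨m, hm⟩ := exists_add_of_le (le_sup_left : (φ p).toAdd ≤ (φ p).toAdd ⊔ (φ q).toAdd)
    obtain ⟨n, hn⟩ := exists_add_of_le (le_sup_right : (φ q).toAdd ≤ (φ p).toAdd ⊔ (φ q).toAdd)
    refine ⟨φ.symm (.ofAdd m), φ.symm (.ofAdd n), φ.injective ?_, fun x y hxy => ?_⟩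
    · apply Multiplicative.toAdd.injective
      simp [← hm, ← hn]
    · have h : (φ p).toAdd + (φ x).toAdd = (φ q).toAdd + (φ y).toAdd := by
        simpa using congrArg (fun t => (φ t).toAdd) hxy
      obtain ⟨z, hz⟩ := exists_add_of_le (sup_le (le_self_add (b := (φ x).toAdd))
        (h ▸ le_self_add) : (φ p).toAdd ⊔ (φ q).toAdd ≤ (φ p).toAdd + (φ x).toAdd)
      refine ⟨φ.symm (.ofAdd z), φ.injective (Multiplicative.toAdd.injective ?_)⟩
      simp [hz, hm]
  exists_ne_one := by
    obtain ⟨x, hx⟩ := exists_ne (0 : M)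
    refine ⟨φ.symm (.ofAdd x), fun h => hx ?_⟩
    simpa using congrArg (fun t => (φ t).toAdd) h

namespace SemidirectMonoid

variable {G : Type u} {P : Type v} [Group G] [Monoid P] {θ : P →* Monoid.End G}

theorem isUnit_iff (hP : IsLCMMonoid P) (a : SemidirectMonoid θ) : IsUnit a ↔ a.right = 1 := by
  constructor
  · rintro ⟨u, rfl⟩
    exact hP.left_eq_one _ _ (congrArg SemidirectMonoid.right u.mul_inv)
  · intro h
    refine ⟨⟨a, ⟨a.left⁻¹, 1⟩, ?_, ?_⟩, rfl⟩ <;> ext <;> simp [h]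

theorem mem_range_iff {p : P} {g : G} : g ∈ MonoidHom.range (θ p) ↔ ∃ x, θ p x = g := Iff.rfl

theorem mul_eq_mul_iff (a b x y : SemidirectMonoid θ) : a * x = b * y ↔
    a.left * θ a.right x.left = b.left * θ b.right y.left ∧ a.right * x.right = b.right * y.right :=
  SemidirectMonoid.ext_iff

theorem isSeparatedLCM (hP : IsLCMMonoid P) (hinj : ∀ p, Function.Injective (θ p))
    (horder : RespectsOrder θ) (hinter : ⨅ p, MonoidHom.range (θ p) = ⊥)
    (hindex : ∀ p, p ≠ 1 → Infinite (G ⧸ MonoidHom.range (θ p))) :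
    IsSeparatedLCM (SemidirectMonoid θ) where
  left_cancel a b c h := by
    obtain ⟨h1, h2⟩ := (mul_eq_mul_iff _ _ _ _).1 h
    exact SemidirectMonoid.ext (hinj _ (mul_left_cancel h1)) (hP.cancel _ _ _ h2)
  right_cancel a b c h := by
    obtain ⟨h1, h2⟩ := (mul_eq_mul_iff _ _ _ _).1 h
    have h3 : a.right = b.right := hP.cancel c.right _ _ (by rw [hP.comm, h2, hP.comm])
    exact SemidirectMonoid.ext (mul_right_cancel (h3 ▸ h1)) h3
  lcm a b := by
    by_cases hd : ∀ x y, a * x ≠ b * y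
    · exact Or.inl hd
    push Not at hd
    obtain ⟨x₀, y₀, h₀⟩ := hd
    obtain ⟨h₁, -⟩ := (mul_eq_mul_iff _ _ _ _).1 h₀
    obtain ⟨m, n, hmn, hl⟩ := hP.lcm a.right b.right
    have hr := horder a.right b.right (a.right * m) (Set.ext fun t => by
      constructor
      · rintro ⟨⟨x, rfl⟩, y, hy⟩
        obtain ⟨z, hz⟩ := hl x y hy.symm
        exact ⟨z, hz.symm⟩
      · rintro ⟨z, rfl⟩
        exact ⟨⟨m * z, (mul_assoc _ _ _).symm⟩, ⟨n * z, by simp only [← mul_assoc, hmn]⟩⟩)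
    -- The group coordinate may come from any common element: those of two common elements differ by
    -- an element of θ_p(G) ∩ θ_q(G), where p, q are the P-coordinates of a, b, and this is
    -- θ_{pm}(G) by `horder`.
    refine Or.inr ⟨⟨x₀.left, m⟩, ⟨y₀.left, n⟩, ?_, fun x y hxy => ?_⟩
    · exact (mul_eq_mul_iff _ _ _ _).2 ⟨h₁, hmn⟩
    · obtain ⟨h₂, h₃⟩ := (mul_eq_mul_iff _ _ _ _).1 hxy
      obtain ⟨z, hz⟩ := hl _ _ h₃
      have hmem : θ a.right (x₀.left⁻¹ * x.left) ∈ (θ (a.right * m)).range := by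
        rw [← hr]
        refine ⟨mem_range_iff.2 ⟨_, rfl⟩, mem_range_iff.2 ⟨y₀.left⁻¹ * y.left, ?_⟩⟩
        rw [map_mul, map_mul, map_inv, map_inv, ← mul_right_inj (b.left * θ b.right y₀.left),
          ← mul_assoc, mul_inv_cancel_right, ← h₂, ← h₁, ← mul_assoc, mul_inv_cancel_right]
      obtain ⟨g, hg⟩ := mem_range_iff.1 hmem
      refine ⟨⟨g, z⟩, SemidirectMonoid.ext ?_ hz⟩
      change a.left * θ a.right x.left = a.left * θ a.right x₀.left * θ (a.right * m) g
      rw [hg, map_mul, map_inv, ← mul_assoc, mul_inv_cancel_right]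
  avoid F hF := by
    classical
    have hF' : ∀ a ∈ F, a.right ≠ 1 := fun a ha h => hF a ha ((isUnit_iff hP a).2 h)
    -- B. H. Neumann's lemma: a finite cover of G by left cosets involves a subgroup of finite
    -- index.
    obtain ⟨g, hg⟩ : ∃ g : G, ∀ a ∈ F, a.left⁻¹ * g ∉ (θ a.right).range := by
      by_contra! hcon
      obtain ⟨a, ha, hfin⟩ := Subgroup.exists_finiteIndex_of_leftCoset_cover
        (s := F) (g := fun a => a.left) (H := fun a => (θ a.right).range) (by
          refine Set.eq_univ_of_forall fun g => ?_
          obtain ⟨a, ha, h⟩ := hcon g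
          exact Set.mem_biUnion ha ((Set.mem_smul_set_iff_inv_smul_mem).2 h))
      have := hindex _ (hF' a ha)
      exact not_finite (G ⧸ (θ a.right).range)
    -- With t a common multiple of the P-coordinates, θ_t(G) lies in every θ_{a.right}(G), so the
    -- whole coset gθ_t(G) misses the cosets that g misses.
    obtain ⟨t, ht⟩ : ∃ t : P, ∀ a ∈ F, ∃ z, t = a.right * z := by
      clear hF hF' hg
      induction F using Finset.induction_on with
      | empty => exact ⟨1, by simp⟩
      | insert a F _ ih =>
        obtain ⟨t, ht⟩ := ih
        refine ⟨a.right * t, fun b hb => ?_⟩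
        rcases Finset.mem_insert.1 hb with rfl | hb
        · exact ⟨t, rfl⟩
        · obtain ⟨z, hz⟩ := ht b hb
          exact ⟨z * a.right, by rw [hP.comm, hz, mul_assoc]⟩
    refine ⟨⟨g, t⟩, fun a ha x y hxy => hg a ha ?_⟩
    obtain ⟨z, hz⟩ := ht a ha
    obtain ⟨h, -⟩ := (mul_eq_mul_iff _ _ _ _).1 hxy
    refine mem_range_iff.2 ⟨y.left * (θ z x.left)⁻¹, ?_⟩
    rw [eq_inv_mul_iff_mul_eq, map_mul, map_inv, ← mul_assoc, mul_inv_eq_iff_eq_mul, ← h]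
    simp [hz]
  unit_sep a ha hne := by
    have hr := (isUnit_iff hP a).1 ha
    have hl : a.left ≠ 1 := fun h => hne (SemidirectMonoid.ext h hr)
    obtain ⟨t, ht⟩ : ∃ t, a.left ∉ (θ t).range := by
      by_contra! hcon
      have : a.left ∈ ⨅ p, MonoidHom.range (θ p) := Subgroup.mem_iInf.2 hcon
      rw [hinter] at this
      exact hl (Subgroup.mem_bot.1 this)
    -- Units have trivial P-coordinate, so a meeting of the two ideals would put `a.left` in θ_t(G).
    refine ⟨⟨1, t⟩, fun x y hxy => ht ?_⟩
    obtain ⟨h, -⟩ := (mul_eq_mul_iff _ _ _ _).1 hxy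
    refine mem_range_iff.2 ⟨y.left * x.left⁻¹, ?_⟩
    simp only [mul_left, mul_right, hr, map_one, one_mul, mul_one] at h
    rw [map_mul, map_inv, mul_inv_eq_iff_eq_mul, ← h]
  exists_nonunit := by
    obtain ⟨p, hp⟩ := hP.exists_ne_one
    exact ⟨⟨1, p⟩, fun h => hp ((isUnit_iff hP _).1 h)⟩

end SemidirectMonoid

theorem isLCMMonoid_of_free {P : Type v} [Monoid P]
    (hP : (∃ k : ℕ, 1 ≤ k ∧ Nonempty (P ≃* Multiplicative (Fin k → ℕ))) ∨
      Nonempty (P ≃* Multiplicative (ℕ →₀ ℕ))) : IsLCMMonoid P := by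
  rcases hP with ⟨k, hk, ⟨φ⟩⟩ | ⟨⟨φ⟩⟩
  · have : Nonempty (Fin k) := ⟨⟨0, hk⟩⟩
    exact isLCMMonoid_of_mulEquiv φ
  · exact isLCMMonoid_of_mulEquiv φ

/-! ### The left regular representation, which shows that C*(S) is nonzero -/

namespace LeftRegular
noncomputable section

variable {S : Type u}

/-- The Hilbert space `ℓ²(S)`. -/
abbrev HilbertSpace (S : Type u) : Type u := lp (fun _ : S => ℂ) 2

open Classical in
/-- The canonical basis vectors of `ℓ²(S)`. -/
def basisVec (s : S) : HilbertSpace S := lp.single 2 s 1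

open Classical in
theorem inner_basisVec (s t : S) :
    inner ℂ (basisVec s) (basisVec t) = if s = t then (1 : ℂ) else 0 := by
  rw [basisVec, basisVec, lp.inner_single_left, lp.single_apply]
  split_ifs with h <;> simp_all

theorem orthonormal_basisVec : Orthonormal ℂ (basisVec : S → HilbertSpace S) := by
  classical
  exact orthonormal_iff_ite.2 inner_basisVec

theorem clm_ext {A B : HilbertSpace S →L[ℂ] HilbertSpace S}
    (h : ∀ s, A (basisVec s) = B (basisVec s)) : A = B := by
  classical
  refine lp.ext_continuousLinearMap (ENNReal.ofNat_ne_top (n := nat_lit 2)) fun i => ?_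
  refine ContinuousLinearMap.ext_ring ?_
  simpa [basisVec] using h i

theorem eq_of_inner {x y : HilbertSpace S}
    (h : ∀ s, inner ℂ (basisVec s) x = inner ℂ (basisVec s) y) : x = y := by
  classical
  ext s
  simpa [basisVec, lp.inner_single_left] using h s

/-- The closed linear span of the `δ_s` with `s ∈ X`. -/
def supportedOn (X : Set S) : Submodule ℂ (HilbertSpace S) :=
  (Submodule.span ℂ (basisVec '' X)).topologicalClosure

instance (X : Set S) : CompleteSpace (supportedOn X) :=
  (Submodule.isClosed_topologicalClosure _).completeSpace_coe

/-- The orthogonal projection of `ℓ²(S)` onto `ℓ²(X)`. -/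
def proj (X : Set S) : HilbertSpace S →L[ℂ] HilbertSpace S := (supportedOn X).starProjection

theorem proj_basisVec_of_mem {X : Set S} {s : S} (h : s ∈ X) :
    proj X (basisVec s) = basisVec s :=
  Submodule.starProjection_eq_self_iff.2
    (Submodule.le_topologicalClosure _ (Submodule.subset_span ⟨s, h, rfl⟩))

theorem proj_basisVec_of_notMem {X : Set S} {s : S} (h : s ∉ X) :
    proj X (basisVec s) = 0 := by
  classical
  refine (Submodule.starProjection_apply_eq_zero_iff _).2 ?_
  rw [supportedOn, Submodule.orthogonal_closure, Submodule.mem_orthogonal]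
  intro x hx
  induction hx using Submodule.span_induction with
  | mem x hx =>
    obtain ⟨t, ht, rfl⟩ := hx
    rw [inner_basisVec, if_neg]
    rintro rfl
    exact h ht
  | zero => simp
  | add x y _ _ hx hy => rw [inner_add_left, hx, hy, add_zero]
  | smul c x _ hx => rw [inner_smul_left, hx, mul_zero]

variable [Monoid S]

/-- The isometry of `ℓ²(S)` mapping `δ_s` to `δ_{ps}`. -/
def shift (hS : IsSeparatedLCM S) (p : S) : HilbertSpace S →L[ℂ] HilbertSpace S :=
  ((orthonormal_basisVec.comp (fun s => p * s)
    (fun a b h => hS.left_cancel p a b h)).orthogonalFamily.linearIsometry).toContinuousLinearMap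

theorem shift_basisVec (hS : IsSeparatedLCM S) (p s : S) :
    shift hS p (basisVec s) = basisVec (p * s) := by
  classical
  simp only [shift, basisVec, LinearIsometry.coe_toContinuousLinearMap]
  rw [OrthogonalFamily.linearIsometry_apply_single]
  simp [basisVec]

theorem star_shift_mul_self (hS : IsSeparatedLCM S) (p : S) :
    star (shift hS p) * shift hS p = 1 := by
  refine clm_ext fun s => eq_of_inner fun t => ?_
  classical
  simp only [ContinuousLinearMap.star_eq_adjoint, mul_apply_eq_comp,
    ContinuousLinearMap.adjoint_inner_right, shift_basisVec, inner_basisVec,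
    one_apply_eq_self]
  exact if_congr ⟨hS.left_cancel p _ _, congrArg _⟩ rfl rfl

theorem star_shift_basisVec_mul (hS : IsSeparatedLCM S) (p s : S) :
    star (shift hS p) (basisVec (p * s)) = basisVec s := by
  rw [← shift_basisVec hS, ← mul_apply_eq_comp, star_shift_mul_self]
  rfl

theorem star_shift_basisVec_of_ne (hS : IsSeparatedLCM S) (p s : S) (h : ∀ t, p * t ≠ s) :
    star (shift hS p) (basisVec s) = 0 := by
  classical
  refine eq_of_inner fun t => ?_
  simp [ContinuousLinearMap.star_eq_adjoint, ContinuousLinearMap.adjoint_inner_right,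
    shift_basisVec, inner_basisVec, h]

/-- The left regular representation of `S` on `ℓ²(S)`. -/
def rep (hS : IsSeparatedLCM S) : SemigroupRep S (HilbertSpace S →L[ℂ] HilbertSpace S) where
  v := shift hS
  e X := proj X.1
  isometry := star_shift_mul_self hS
  projection X := isStarProjection_starProjection
  v_mul p q := clm_ext fun s => by simp [shift_basisVec, mul_assoc]
  v_conj p X := clm_ext fun s => by
    simp only [mul_apply_eq_comp]
    by_cases h : ∃ t, p * t = s
    · obtain ⟨t, rfl⟩ := h
      rw [star_shift_basisVec_mul]
      by_cases ht : t ∈ X.1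
      · rw [proj_basisVec_of_mem ht, shift_basisVec, proj_basisVec_of_mem (X := (X.translate p).1) ⟨t, ht, rfl⟩]
      · rw [proj_basisVec_of_notMem ht, map_zero, proj_basisVec_of_notMem]
        rintro ⟨t', ht', h⟩
        exact ht (hS.left_cancel _ _ _ h ▸ ht')
    · push Not at h
      rw [star_shift_basisVec_of_ne hS p s h, map_zero, map_zero, proj_basisVec_of_notMem]
      rintro ⟨t, -, ht⟩
      exact h t ht
  e_empty := clm_ext fun s => proj_basisVec_of_notMem (Set.notMem_empty s)
  e_univ := clm_ext fun s => proj_basisVec_of_mem (Set.mem_univ s)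
  e_inter X Y Z h := clm_ext fun s => by
    simp only [mul_apply_eq_comp, h]
    by_cases hY : s ∈ Y.1
    · rw [proj_basisVec_of_mem hY]
      by_cases hX : s ∈ X.1
      · rw [proj_basisVec_of_mem hX, proj_basisVec_of_mem (X := X.1 ∩ Y.1) ⟨hX, hY⟩]
      · rw [proj_basisVec_of_notMem hX, proj_basisVec_of_notMem fun h => hX h.1]
    · rw [proj_basisVec_of_notMem hY, map_zero, proj_basisVec_of_notMem fun h => hY h.2]

end
end LeftRegular

namespace FullCStar

theorem nontrivial {S : Type u} [Monoid S] (hS : IsSeparatedLCM S) : Nontrivial (FullCStar S) := by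
  have : Nontrivial (LeftRegular.HilbertSpace S) :=
    ⟨LeftRegular.basisVec 1, 0, LeftRegular.orthonormal_basisVec.ne_zero 1⟩
  obtain ⟨π, -, -⟩ := exists_lift (LeftRegular.rep hS)
  exact π.toRingHom.domain_nontrivial

end FullCStar

/-! ### Products of generators and the dense span of the v_p v_q^* -/

namespace FullCStar

section relations

variable {S : Type u} [Semigroup S]

theorem star_v_mul_v (p : S) : star (v p) * v p = 1 := (universalRep S).isometry p

theorem v_mul_v (p q : S) : v p * v q = v (p * q) := (universalRep S).v_mul p q

theorem v_mul_star_v (p : S) : v p * star (v p) = e (ConstructibleIdeal.univ.translate p) := by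
  have h := (universalRep S).v_conj p ConstructibleIdeal.univ
  rwa [(universalRep S).e_univ, mul_one] at h

theorem norm_v_le [Nontrivial (FullCStar S)] (p : S) : ‖v p‖ ≤ 1 :=
  norm_le_one_of_isometry (star_v_mul_v p)

/-- Inserting the range projections reduces v_p^* v_q to the intersection pS ∩ qS. -/
theorem star_v_mul_v_eq (p q : S) :
    star (v p) * v q = star (v p) * ((v p * star (v p)) * (v q * star (v q))) * v q := by
  simp only [mul_assoc, star_v_mul_v, mul_one]
  rw [← mul_assoc (star (v p)) (v p), star_v_mul_v, one_mul]

theorem range_mul_range_of_disjoint {p q : S} (h : ∀ x y, p * x ≠ q * y) :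
    (v p * star (v p)) * (v q * star (v q)) = 0 := by
  rw [v_mul_star_v, v_mul_star_v, ← (universalRep S).e_empty]
  refine (universalRep S).e_inter _ _ _ (Set.ext fun t => ?_)
  simp only [ConstructibleIdeal.empty, ConstructibleIdeal.translate, ConstructibleIdeal.univ,
    Set.mem_empty_iff_false, Set.mem_inter_iff, Set.mem_image, Set.mem_univ, true_and, false_iff]
  rintro ⟨⟨x, rfl⟩, y, hy⟩
  exact h x y hy.symm

theorem star_v_mul_v_of_disjoint {p q : S} (h : ∀ x y, p * x ≠ q * y) :
    star (v p) * v q = 0 := by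
  rw [star_v_mul_v_eq, range_mul_range_of_disjoint h, mul_zero, zero_mul]

end relations

variable {S : Type u} [Monoid S]

theorem range_mul_range_of_lcm {p q m n : S} (hmn : p * m = q * n)
    (h : ∀ x y, p * x = q * y → ∃ z, p * x = p * m * z) :
    (v p * star (v p)) * (v q * star (v q)) = v (p * m) * star (v (p * m)) := by
  rw [v_mul_star_v, v_mul_star_v, v_mul_star_v]
  refine (universalRep S).e_inter _ _ _ (Set.ext fun t => ?_)
  simp only [ConstructibleIdeal.translate, ConstructibleIdeal.univ,
    Set.mem_inter_iff, Set.mem_image, Set.mem_univ, true_and]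
  constructor
  · rintro ⟨z, rfl⟩
    exact ⟨⟨m * z, (mul_assoc _ _ _).symm⟩, ⟨n * z, by rw [hmn, mul_assoc]⟩⟩
  · rintro ⟨⟨x, rfl⟩, y, hy⟩
    obtain ⟨z, hz⟩ := h x y hy.symm
    exact ⟨z, hz.symm⟩

/-- This rewriting rule is what closes the span of the v_p v_q^* under multiplication. -/
theorem star_v_mul_v_of_lcm {p q m n : S} (hmn : p * m = q * n)
    (h : ∀ x y, p * x = q * y → ∃ z, p * x = p * m * z) :
    star (v p) * v q = v m * star (v n) := by
  rw [star_v_mul_v_eq, range_mul_range_of_lcm hmn h]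
  nth_rw 2 [hmn]
  rw [← v_mul_v, ← v_mul_v, star_mul]
  simp only [mul_assoc, star_v_mul_v, mul_one]
  rw [← mul_assoc (star (v p)) (v p), star_v_mul_v, one_mul]

theorem star_v_mul_v_mul (p x : S) : star (v p) * v (p * x) = v x := by
  rw [← v_mul_v, ← mul_assoc, star_v_mul_v, one_mul]

theorem star_v_mul_mul_v (p x : S) : star (v (p * x)) * v p = star (v x) := by
  rw [← star_v_mul_v_mul p x, star_mul, star_star]

theorem v_one : v (1 : S) = 1 := by
  have h : v (1 : S) * v 1 = v 1 := by rw [v_mul_v, one_mul]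
  calc v (1 : S) = star (v (1 : S)) * v 1 * v 1 := by rw [star_v_mul_v, one_mul]
    _ = 1 := by rw [mul_assoc, h, star_v_mul_v]

variable (S) in
/-- The linear span of the elements `v_p v_q^*`. -/
noncomputable def coreSpan : Submodule ℂ (FullCStar S) :=
  Submodule.span ℂ (Set.range fun k : S × S => v k.1 * star (v k.2))

theorem mem_coreSpan (p q : S) : v p * star (v q) ∈ coreSpan S :=
  Submodule.subset_span ⟨(p, q), rfl⟩

theorem mul_mem_coreSpan (hS : IsSeparatedLCM S) {x y : FullCStar S} (hx : x ∈ coreSpan S)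
    (hy : y ∈ coreSpan S) : x * y ∈ coreSpan S := by
  refine Submodule.mul_le.1 ?_ x hx y hy
  rw [coreSpan, Submodule.span_mul_span, Submodule.span_le]
  rintro _ ⟨_, ⟨⟨p, q⟩, rfl⟩, _, ⟨⟨r, s⟩, rfl⟩, rfl⟩
  have h : v p * star (v q) * (v r * star (v s)) = v p * (star (v q) * v r) * star (v s) := by
    simp only [mul_assoc]
  simp only [SetLike.mem_coe, h]
  rcases hS.lcm q r with hd | ⟨m, n, hmn, hl⟩
  · rw [star_v_mul_v_of_disjoint hd, mul_zero, zero_mul]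
    exact zero_mem _
  · rw [star_v_mul_v_of_lcm hmn hl, ← mul_assoc, v_mul_v, mul_assoc, ← star_mul, v_mul_v]
    exact mem_coreSpan _ _

theorem star_mem_coreSpan {x : FullCStar S} (hx : x ∈ coreSpan S) : star x ∈ coreSpan S := by
  induction hx using Submodule.span_induction with
  | mem x hx =>
    obtain ⟨⟨p, q⟩, rfl⟩ := hx
    simpa using mem_coreSpan q p
  | zero => simp
  | add x y _ _ hx hy => rw [star_add]; exact add_mem hx hy
  | smul c x _ hx => rw [star_smul]; exact Submodule.smul_mem _ _ hx

theorem one_mem_coreSpan : (1 : FullCStar S) ∈ coreSpan S := by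
  simpa [v_one] using mem_coreSpan (1 : S) 1

/-- The linear span of the `v_p v_q^*` as a `*`-subalgebra. -/
noncomputable def coreSubalgebra (hS : IsSeparatedLCM S) : StarSubalgebra ℂ (FullCStar S) where
  carrier := coreSpan S
  mul_mem' := mul_mem_coreSpan hS
  add_mem' := add_mem
  algebraMap_mem' c := by
    rw [Algebra.algebraMap_eq_smul_one]
    exact Submodule.smul_mem _ _ (one_mem_coreSpan)
  star_mem' := star_mem_coreSpan

theorem e_eq_zero_or (hS : IsSeparatedLCM S) (X : ConstructibleIdeal S) :
    e X = 0 ∨ ∃ p, e X = v p * star (v p) := by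
  rcases hS.constructible X.2 with h | ⟨p, h⟩
  · left
    rw [← (universalRep S).e_empty]
    exact congrArg e (Subtype.ext h)
  · refine Or.inr ⟨p, ?_⟩
    rw [v_mul_star_v]
    exact congrArg e (Subtype.ext (h.trans Set.image_univ.symm))

/-- The `*`-subalgebra spanned by the v_p v_q^* contains all generators: v_p = v_p v_1^*, and e_X is
0 or some v_p v_p^*. -/
theorem exists_mem_coreSpan_norm_sub_lt (hS : IsSeparatedLCM S) (a : FullCStar S) {ε : ℝ}
    (hε : 0 < ε) : ∃ b ∈ coreSpan S, ‖a - b‖ < ε := by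
  let ι : FullCStar S →⋆ₐ[ℂ] BigSum S := (subalgebra S).subtype
  have hle : StarAlgebra.adjoin ℂ (Set.range (bigV (S := S)) ∪ Set.range (bigE (S := S))) ≤
      (coreSubalgebra hS).map ι := by
    refine StarAlgebra.adjoin_le ?_
    rintro _ (⟨p, rfl⟩ | ⟨X, rfl⟩)
    · refine ⟨v p, ?_, rfl⟩
      change v p ∈ coreSpan S
      simpa [v_one] using mem_coreSpan p 1
    · refine ⟨e X, ?_, rfl⟩
      change e X ∈ coreSpan S
      rcases e_eq_zero_or hS X with h | ⟨p, h⟩ <;> rw [h]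
      · exact zero_mem _
      · exact mem_coreSpan p p
  have ha : a.1 ∈ closure ((StarAlgebra.adjoin ℂ
    (Set.range (bigV (S := S)) ∪ Set.range (bigE (S := S))) : Set (BigSum S))) := a.2
  obtain ⟨y, hy, hay⟩ := Metric.mem_closure_iff.1 ha ε hε
  obtain ⟨b, hb, rfl⟩ := hle hy
  refine ⟨b, hb, ?_⟩
  rw [dist_eq_norm] at hay
  exact hay

end FullCStar

/-! ### Characters of the diagonal and compression to scalars -/

namespace FullCStar

variable {S : Type u} [Monoid S]

theorem isClosed_diagonal : IsClosed (diagonal S : Set (FullCStar S)) :=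
  StarSubalgebra.isClosed_topologicalClosure _

theorem e_mul_e_comm (hS : IsSeparatedLCM S) (X Y : ConstructibleIdeal S) :
    e X * e Y = e Y * e X := by
  have : IsLeftCancelMul S := ⟨fun a _ _ h => hS.left_cancel a _ _ h⟩
  exact ((universalRep S).e_inter X Y ⟨X.1 ∩ Y.1, X.2.inter Y.2⟩ rfl).trans
    ((universalRep S).e_inter Y X ⟨X.1 ∩ Y.1, X.2.inter Y.2⟩ (Set.inter_comm _ _)).symm

theorem diagonal_mul_comm (hS : IsSeparatedLCM S) (x y : diagonal S) : x * y = y * x := by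
  have hcomm : IsMulCommutative (StarAlgebra.adjoin ℂ (Set.range (e (S := S)))) := by
    refine StarAlgebra.isMulCommutative_adjoin ℂ ?_ ?_
    · rintro _ ⟨X, rfl⟩ _ ⟨Y, rfl⟩
      exact e_mul_e_comm hS X Y
    · rintro _ ⟨X, rfl⟩ _ ⟨Y, rfl⟩
      rw [show star (e Y) = e Y from ((universalRep S).projection Y).isSelfAdjoint]
      exact e_mul_e_comm hS X Y
  exact (StarSubalgebra.commRingTopologicalClosure _ (fun x y => hcomm.is_comm.comm x y)).mul_comm x y

/-- D is a commutative C*-algebra, so its Gelfand transform is injective; characters are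
contractive. -/
theorem exists_character_ne_zero (hS : IsSeparatedLCM S) {d : diagonal S} (hd : d ≠ 0) :
    ∃ χ : diagonal S →ₐ[ℂ] ℂ, χ d ≠ 0 ∧ ∀ x, ‖χ x‖ ≤ ‖x‖ := by
  have := nontrivial hS
  have := isClosed_diagonal (S := S)
  let _ : CommCStarAlgebra (diagonal S) :=
    { (inferInstance : CStarAlgebra (diagonal S)) with mul_comm := diagonal_mul_comm hS }
  by_contra! hcon
  apply hd
  apply (gelfandTransform_isometry (diagonal S)).injective
  ext φ
  rw [map_zero]
  by_contra hne
  obtain ⟨x, hx⟩ := hcon (WeakDual.CharacterSpace.toAlgHom φ) hne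
  exact absurd (AlgHom.norm_apply_le_self (WeakDual.CharacterSpace.toAlgHom φ) x) (not_le.2 hx)

/-- The range projection of `v_p` as an element of the diagonal. -/
noncomputable def rangeProj (p : S) : diagonal S :=
  ⟨v p * star (v p), by
    rw [v_mul_star_v]
    exact StarSubalgebra.le_topologicalClosure _ (StarAlgebra.subset_adjoin _ _ ⟨_, rfl⟩)⟩

theorem rangeProj_idem (p : S) : rangeProj p * rangeProj p = rangeProj p := by
  apply Subtype.ext
  change v p * star (v p) * (v p * star (v p)) = v p * star (v p)
  rw [mul_assoc, ← mul_assoc (star (v p)), star_v_mul_v, one_mul]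

theorem rangeProj_one : rangeProj (1 : S) = 1 := by
  apply Subtype.ext
  change v 1 * star (v 1) = (1 : FullCStar S)
  rw [v_one, star_one, one_mul]

theorem rangeProj_mul_mul (p x : S) : rangeProj (p * x) * rangeProj p = rangeProj (p * x) := by
  apply Subtype.ext
  change v (p * x) * star (v (p * x)) * (v p * star (v p)) = v (p * x) * star (v (p * x))
  rw [mul_assoc, ← mul_assoc (star _), star_v_mul_mul_v, ← star_mul, v_mul_v]

theorem character_rangeProj (χ : diagonal S →ₐ[ℂ] ℂ) (p : S) :
    χ (rangeProj p) = 0 ∨ χ (rangeProj p) = 1 := by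
  have h : χ (rangeProj p) * χ (rangeProj p) = χ (rangeProj p) := by
    rw [← map_mul, rangeProj_idem]
  exact IsIdempotentElem.iff_eq_zero_or_one.1 h

/-- A product of two range projections is 0 or the range projection of a least common multiple. As χ
is multiplicative, the value 1 on both factors excludes 0 and passes to the multiple. -/
theorem exists_character_mul (hS : IsSeparatedLCM S) (χ : diagonal S →ₐ[ℂ] ℂ) (A : Finset S)
    (hA : ∀ a ∈ A, χ (rangeProj a) = 1) :
    ∃ r, χ (rangeProj r) = 1 ∧ ∀ a ∈ A, ∃ x, r = a * x := by
  classical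
  induction A using Finset.induction_on with
  | empty => exact ⟨1, by rw [rangeProj_one, map_one], by simp⟩
  | insert a A _ ih =>
    obtain ⟨r, hr, hrA⟩ := ih fun b hb => hA b (Finset.mem_insert_of_mem hb)
    have h1 : χ (rangeProj r * rangeProj a) = 1 := by
      rw [map_mul, hr, hA a (Finset.mem_insert_self _ _), one_mul]
    rcases hS.lcm r a with hd | ⟨m, n, hmn, hl⟩
    · have h0 : rangeProj r * rangeProj a = 0 := Subtype.ext (range_mul_range_of_disjoint hd)
      rw [h0, map_zero] at h1
      exact absurd h1 zero_ne_one
    · have h2 : rangeProj r * rangeProj a = rangeProj (r * m) :=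
        Subtype.ext (range_mul_range_of_lcm hmn hl)
      refine ⟨r * m, h2 ▸ h1, fun b hb => ?_⟩
      rcases Finset.mem_insert.1 hb with rfl | hb
      · exact ⟨n, hmn⟩
      · obtain ⟨x, hx⟩ := hrA b hb
        exact ⟨x * m, by rw [hx, mul_assoc]⟩

/-- A conditional expectation onto the diagonal is, after composition with a character and on
finitely many of the `v_p v_q^*`, implemented by compression with an isometry `v_c`. -/
theorem exists_compression (hS : IsSeparatedLCM S) {Φ : FullCStar S →ₗ[ℂ] diagonal S}
    (hΦ : IsDiagonalMap S Φ) (χ : diagonal S →ₐ[ℂ] ℂ) (K : Finset (S × S)) :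
    ∃ c : S, ∀ k ∈ K, star (v c) * (v k.1 * star (v k.2)) * v c =
      χ (Φ (v k.1 * star (v k.2))) • (1 : FullCStar S) := by
  classical
  obtain ⟨r, hr, hrA⟩ := exists_character_mul hS χ
    ((K.image Prod.fst ∪ K.image Prod.snd).filter fun a => χ (rangeProj a) = 1)
    fun a ha => (Finset.mem_filter.1 ha).2
  -- If r = ax, then v_r v_r^* ≤ v_a v_a^* forces χ(v_a v_a^*) = 1, so r lies outside each ideal to
  -- be avoided.
  obtain ⟨s, hs⟩ := hS.exists_avoiding r
    ((K.image Prod.fst ∪ K.image Prod.snd).filter fun a => χ (rangeProj a) ≠ 1) (by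
      rintro a ha x rfl
      apply (Finset.mem_filter.1 ha).2
      rw [← rangeProj_mul_mul, map_mul] at hr
      exact (character_rangeProj χ a).resolve_left fun h => by simp [h] at hr)
  -- The position of rs now reads off χ: either a divides rs on the left and χ is 1, or rsS misses
  -- aS and χ is 0.
  have hdec : ∀ a ∈ K.image Prod.fst ∪ K.image Prod.snd,
      (χ (rangeProj a) = 1 ∧ ∃ x, r * s = a * x) ∨
      (χ (rangeProj a) = 0 ∧ ∀ x y, r * s * x ≠ a * y) := by
    intro a ha
    rcases character_rangeProj χ a with h | h
    · exact Or.inr ⟨h, hs a (Finset.mem_filter.2 ⟨ha, by simp [h]⟩)⟩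
    · obtain ⟨x, hx⟩ := hrA a (Finset.mem_filter.2 ⟨ha, h⟩)
      exact Or.inl ⟨h, x * s, by rw [hx, mul_assoc]⟩
  obtain ⟨d, hd⟩ := hS.exists_disjoint_pairs (r * s) K
  refine ⟨r * s * d, fun ⟨p, q⟩ hk => ?_⟩
  have hp := hdec p (Finset.mem_union_left _ (Finset.mem_image_of_mem Prod.fst hk))
  have hq := hdec q (Finset.mem_union_right _ (Finset.mem_image_of_mem Prod.snd hk))
  have hΦpq := hΦ p q
  have hassoc : star (v (r * s * d)) * (v p * star (v q)) * v (r * s * d) =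
      (star (v (r * s * d)) * v p) * (star (v q) * v (r * s * d)) := by
    simp only [mul_assoc]
  simp only [hassoc]
  have hzero : ∀ a, (∀ x y, r * s * x ≠ a * y) → star (v (r * s * d)) * v a = 0 := fun a ha =>
    star_v_mul_v_of_disjoint fun x y => by simpa only [mul_assoc] using ha (d * x) y
  have hzero' : ∀ a, (∀ x y, r * s * x ≠ a * y) → star (v a) * v (r * s * d) = 0 := fun a ha => by
    rw [← star_star (v (r * s * d)), ← star_mul, hzero a ha, star_zero]
  by_cases hpq : p = q
  · subst hpq
    rw [if_pos rfl] at hΦpq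
    have hΦpq' : Φ (v p * star (v p)) = rangeProj p := Subtype.ext hΦpq
    rw [hΦpq']
    rcases hp with ⟨h1, x, hx⟩ | ⟨h0, hdis⟩
    · rw [h1, one_smul, hx, mul_assoc p, star_v_mul_mul_v, star_v_mul_v_mul, star_v_mul_v]
    · rw [h0, zero_smul, hzero p hdis, zero_mul]
  · rw [if_neg hpq] at hΦpq
    have hΦpq' : Φ (v p * star (v q)) = 0 := Subtype.ext hΦpq
    rw [hΦpq', map_zero, zero_smul]
    rcases hp with ⟨-, x, hx⟩ | ⟨-, hdis⟩
    · rcases hq with ⟨-, y, hy⟩ | ⟨-, hdis⟩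
      · nth_rw 1 [hx]
        rw [hy, mul_assoc p, star_v_mul_mul_v, mul_assoc q, star_v_mul_v_mul]
        exact star_v_mul_v_of_disjoint (hd (p, q) hk hpq x y hx hy)
      · rw [hzero' q hdis, mul_zero]
    · rw [hzero p hdis, zero_mul]

theorem exists_compression_of_mem_coreSpan (hS : IsSeparatedLCM S)
    {Φ : FullCStar S →ₗ[ℂ] diagonal S} (hΦ : IsDiagonalMap S Φ) (χ : diagonal S →ₐ[ℂ] ℂ)
    {b : FullCStar S} (hb : b ∈ coreSpan S) :
    ∃ c : S, star (v c) * b * v c = χ (Φ b) • (1 : FullCStar S) := by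
  obtain ⟨f, rfl⟩ := (Finsupp.mem_span_range_iff_exists_finsupp).1 hb
  obtain ⟨c, hc⟩ := exists_compression hS hΦ χ f.support
  refine ⟨c, ?_⟩
  simp only [Finsupp.sum, Finset.mul_sum, Finset.sum_mul, map_sum, Finset.sum_smul]
  refine Finset.sum_congr rfl fun k hk => ?_
  rw [mul_smul_comm, smul_mul_assoc, hc k hk, map_smul, map_smul, smul_assoc]

theorem exists_isUnit_compression (hS : IsSeparatedLCM S)
    {Φ : FullCStar S →ₗ[ℂ] diagonal S} (hE : IsConditionalExpectation (diagonal S) Φ)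
    (hΦ : IsDiagonalMap S Φ) (hfaithful : IsFaithfulOnPositive Φ) {a : FullCStar S}
    (ha : 0 ≤ a) (ha0 : a ≠ 0) : ∃ c : S, IsUnit (star (v c) * a * v c) := by
  have := nontrivial hS
  obtain ⟨χ, hχ, hχn⟩ := exists_character_ne_zero hS fun h => ha0 (hfaithful a ha h)
  -- Half of |χ(Φ(a))|, because replacing a by b costs ‖a - b‖ twice: in the compression and in the
  -- scalar.
  obtain ⟨b, hb, hab⟩ := exists_mem_coreSpan_norm_sub_lt hS a (half_pos (norm_pos_iff.2 hχ))
  obtain ⟨c, hc⟩ := exists_compression_of_mem_coreSpan hS hΦ χ hb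
  refine ⟨c, ?_⟩
  have h1 : ‖star (v c) * (a - b) * v c‖ ≤ ‖a - b‖ := by
    calc _ ≤ ‖star (v c)‖ * ‖a - b‖ * ‖v c‖ := norm_mul₃_le
      _ ≤ 1 * ‖a - b‖ * 1 := by
        rw [norm_star]
        gcongr <;> exact norm_v_le c
      _ = ‖a - b‖ := by ring
  have h2 : ‖χ (Φ b) - χ (Φ a)‖ ≤ ‖a - b‖ := by
    rw [← map_sub, ← map_sub, norm_sub_rev]
    exact (hχn _).trans (hE.norm_le _)
  have h3 : ‖star (v c) * a * v c - χ (Φ a) • 1‖ < ‖χ (Φ a)‖ := by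
    have : star (v c) * a * v c - χ (Φ a) • 1 =
        star (v c) * (a - b) * v c + (χ (Φ b) - χ (Φ a)) • 1 := by
      rw [mul_sub, sub_mul, hc, sub_smul]; abel
    rw [this]
    calc _ ≤ ‖star (v c) * (a - b) * v c‖ + ‖(χ (Φ b) - χ (Φ a)) • (1 : FullCStar S)‖ :=
          norm_add_le _ _
      _ ≤ ‖a - b‖ + ‖a - b‖ := by
        rw [norm_smul, CStarRing.norm_one, mul_one]
        exact add_le_add h1 h2
      _ < _ := by linarith
  have h4 : ‖(χ (Φ a))⁻¹ • (star (v c) * a * v c) - 1‖ < 1 := by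
    have : (χ (Φ a))⁻¹ • (star (v c) * a * v c) - 1 =
        (χ (Φ a))⁻¹ • (star (v c) * a * v c - χ (Φ a) • 1) := by
      rw [smul_sub, inv_smul_smul₀ hχ]
    rw [this, norm_smul, norm_inv, inv_mul_lt_one₀ (norm_pos_iff.2 hχ)]
    exact h3
  have h5 : IsUnit ((χ (Φ a))⁻¹ • (star (v c) * a * v c)) := by
    rw [norm_sub_rev] at h4
    simpa using isUnit_one_sub_of_norm_lt_one h4
  simpa [Units.smul_def, smul_smul, hχ] using h5.smul (Units.mk0 _ hχ)

/-! ### Simplicity and pure infiniteness -/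

theorem isSimpleCStar (hS : IsSeparatedLCM S)
    {Φ : FullCStar S →ₗ[ℂ] diagonal S} (hE : IsConditionalExpectation (diagonal S) Φ)
    (hΦ : IsDiagonalMap S Φ) (hfaithful : IsFaithfulOnPositive Φ) :
    IsSimpleCStar (FullCStar S) := by
  refine ⟨nontrivial hS, fun I _ => or_iff_not_imp_left.2 fun hI => ?_⟩
  obtain ⟨x, hx, hx0⟩ : ∃ x ∈ I, x ≠ 0 := by
    by_contra! hcon
    exact hI (eq_bot_iff.2 fun x hx => (TwoSidedIdeal.mem_bot _).2 (hcon x hx))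
  obtain ⟨c, u, hu⟩ := exists_isUnit_compression hS hE hΦ hfaithful
    (star_mul_self_nonneg x) ((CStarRing.star_mul_self_ne_zero_iff x).2 hx0)
  have h1 : (1 : FullCStar S) ∈ I := by
    have h2 : ↑u⁻¹ * (star (v c) * (star x * x) * v c) ∈ I :=
      I.mul_mem_left _ _ (I.mul_mem_right _ _ (I.mul_mem_left _ _ (I.mul_mem_left _ _ hx)))
    rwa [← hu, Units.inv_mul] at h2
  exact eq_top_iff.2 fun y _ => by simpa using I.mul_mem_left y 1 h1

/-- For a nonunit a some sS misses aS, so the range projection of v_a annihilates v_s ≠ 0. -/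
theorem exists_v_mul_star_v_ne_one (hS : IsSeparatedLCM S) :
    ∃ c : S, v c * star (v c) ≠ 1 := by
  have := nontrivial hS
  obtain ⟨a, ha⟩ := hS.exists_nonunit
  obtain ⟨s, hs⟩ := hS.avoid {a} (by simpa using ha)
  refine ⟨a, fun h => ?_⟩
  have h0 : star (v s) * v a = 0 := star_v_mul_v_of_disjoint (hs a (Finset.mem_singleton_self a))
  have h1 : star (v s) = 0 := by rw [← mul_one (star (v s)), ← h, ← mul_assoc, h0, zero_mul]
  have h2 := star_v_mul_v s
  rw [h1, zero_mul] at h2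
  exact zero_ne_one h2

/-- Take z = y^{-1/2}. -/
theorem exists_isSelfAdjoint_mul_mul_eq_one {y : FullCStar S} (hy : 0 ≤ y) (hu : IsUnit y) :
    ∃ z : FullCStar S, IsSelfAdjoint z ∧ z * y * z = 1 := by
  have hs : CFC.sqrt y * CFC.sqrt y = y := CFC.sqrt_mul_sqrt_self y
  have hsu : IsUnit (CFC.sqrt y) := isUnit_mul_self_iff.1 (hs.symm ▸ hu)
  have hsa : IsSelfAdjoint (CFC.sqrt y) := (CFC.sqrt_nonneg y).isSelfAdjoint
  obtain ⟨w, hw⟩ := hsu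
  refine ⟨↑w⁻¹, ?_, ?_⟩
  · have : star w = w := Units.ext (by rw [Units.coe_star, hw]; exact hsa)
    rw [IsSelfAdjoint, ← Units.coe_star, star_inv, this]
  · rw [← hs, ← hw, ← mul_assoc, Units.inv_mul, one_mul, Units.mul_inv]

theorem isPurelyInfinite (hS : IsSeparatedLCM S)
    {Φ : FullCStar S →ₗ[ℂ] diagonal S} (hE : IsConditionalExpectation (diagonal S) Φ)
    (hΦ : IsDiagonalMap S Φ) (hfaithful : IsFaithfulOnPositive Φ) :
    IsPurelyInfinite (FullCStar S) := by
  intro B hB hB0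
  obtain ⟨x, hx, hx0⟩ : ∃ x ∈ B, x ≠ 0 := by
    by_contra! hcon
    exact hB0 (eq_bot_iff.2 fun x hx => NonUnitalStarAlgebra.mem_bot.2 (hcon x hx))
  obtain ⟨c, hu⟩ := exists_isUnit_compression hS hE hΦ hfaithful
    (star_mul_self_nonneg x) ((CStarRing.star_mul_self_ne_zero_iff x).2 hx0)
  obtain ⟨z, hz, hz1⟩ := exists_isSelfAdjoint_mul_mul_eq_one
    (star_left_conjugate_nonneg (star_mul_self_nonneg x) (v c)) hu
  obtain ⟨t, ht⟩ : ∃ t, t = v c * z := ⟨_, rfl⟩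
  have hw : star (x * t) * (x * t) = 1 := by
    rw [ht, ← hz1]
    simp only [star_mul, hz.star_eq, mul_assoc]
  obtain ⟨w, hwdef⟩ : ∃ w, w = x * t := ⟨_, rfl⟩
  rw [← hwdef] at hw
  -- From t t^* ≤ ‖t t^*‖; heredity then puts w w^* in B, since x x^* is in B.
  have hle : w * star w ≤ (‖t * star t‖ : ℂ) • (x * star x) := by
    have h1 : t * star t ≤ algebraMap ℝ (FullCStar S) ‖t * star t‖ :=
      (IsSelfAdjoint.mul_star_self t).le_algebraMap_norm_self
    have h2 := star_right_conjugate_le_conjugate h1 x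
    have h3 : x * algebraMap ℝ (FullCStar S) ‖t * star t‖ * star x =
        (‖t * star t‖ : ℂ) • (x * star x) := by
      rw [Algebra.algebraMap_eq_smul_one, mul_smul_comm, mul_one, smul_mul_assoc]
      exact (Complex.coe_smul _ _).symm
    rw [h3] at h2
    simpa only [hwdef, star_mul, mul_assoc] using h2
  refine ⟨w * star w, hB.2 _ _ (mul_star_self_nonneg w) hle
    (B.smul_mem' _ (mul_mem hx (star_mem hx))), ⟨?_, ?_⟩, ?_⟩
  · rw [IsIdempotentElem, mul_assoc, ← mul_assoc (star w), hw, one_mul]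
  · exact IsSelfAdjoint.mul_star_self w
  obtain ⟨d, hd⟩ := exists_v_mul_star_v_ne_one hS
  have hss : w * v d * star w * star (w * v d * star w) = w * (v d * star (v d)) * star w := by
    simp only [star_mul, star_star, mul_assoc]
    rw [← mul_assoc (star w) w, hw, one_mul]
  -- The nonunitary isometry v_d transported by w to the corner of w w^*.
  refine ⟨w * v d * star w, ?_, ?_, ?_⟩
  · simp only [star_mul, star_star, mul_assoc]
    rw [← mul_assoc (star w) w, hw, one_mul, ← mul_assoc (star (v d)), star_v_mul_v, one_mul]
  · rw [hss]
    have h1 : v d * star (v d) ≤ 1 := by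
      rw [v_mul_star_v]
      exact ((universalRep S).projection _).le_one
    simpa using star_right_conjugate_le_conjugate h1 w
  · rw [hss]
    intro h
    apply hd
    calc v d * star (v d) = star w * (w * (v d * star (v d)) * star w) * w := by
          simp only [mul_assoc, hw, mul_one]
          rw [← mul_assoc (star w) w, hw, one_mul]
      _ = 1 := by rw [h, ← mul_assoc, hw, one_mul, hw]

end FullCStar

theorem mainTheorem3 {G : Type u} {P : Type v} [Group G] [Monoid P]
    (hP : (∃ k : ℕ, 1 ≤ k ∧ Nonempty (P ≃* Multiplicative (Fin k → ℕ))) ∨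
      Nonempty (P ≃* Multiplicative (ℕ →₀ ℕ)))
    (θ : P →* Monoid.End G)
    (hinj : ∀ p, Function.Injective (θ p))
    (horder : RespectsOrder θ)
    (hinter : ⨅ p, MonoidHom.range (θ p) = ⊥)
    (hindex : ∀ p, p ≠ 1 → Infinite (G ⧸ MonoidHom.range (θ p)))
    (hfaithful : ∃ Φ : FullCStar (SemidirectMonoid θ) →ₗ[ℂ]
        FullCStar.diagonal (SemidirectMonoid θ),
      IsConditionalExpectation (FullCStar.diagonal (SemidirectMonoid θ)) Φ ∧
        IsDiagonalMap (SemidirectMonoid θ) Φ ∧ IsFaithfulOnPositive Φ) :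
    IsPurelyInfinite (FullCStar (SemidirectMonoid θ)) ∧
      IsSimpleCStar (FullCStar (SemidirectMonoid θ)) := by
  have hS := SemidirectMonoid.isSeparatedLCM (isLCMMonoid_of_free hP) hinj horder hinter hindex
  obtain ⟨Φ, hE, hΦ, hfaith⟩ := hfaithful
  exact ⟨FullCStar.isPurelyInfinite hS hE hΦ hfaith, FullCStar.isSimpleCStar hS hE hΦ hfaith⟩
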